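/- Let $f\colon\mathbb R^n\to\mathbb R\cup\{+\infty\}$ be lower semicontinuous and let $\Omega\subset\mathbb R^n$ be nonempty and closed, where $\mathbb R^n$ carries the Euclidean norm and $\mathbb S$ is its unit sphere. Assume that $\operatorname{dom} f\cap\Omega$ is unbounded, where $\operatorname{dom} f=\{x: f(x)<+\infty\}$, and that $f$ is bounded from below on $\Omega$, so that $f_*:=\inf_{x\in\Omega}f(x)$ is finite. Let $\mathrm{Sol}:=\{x\in\Omega: f(x)\le f(y)\ \text{for all}\ y\in\Omega\}$ be the solution set of the problem $\min_{x\in\Omega}f(x)$. Notation. For a subset $D$ of a Euclidean space and $a\in D$, let $\widehat N_D(a):=\{v:\limsup_{x\to a,\ x\in D\setminus\{a\}}\langle v,x-a\rangle/\|x-a\|\le 0\}$ be the regular (Fréchet) normal cone, and $\widehat N_D(a):=\emptyset$ for $a\notin D$. Let $\operatorname{epi}f:=\{(x,r)\in\mathbb R^n\times\mathbb R: r\ge f(x)\}$, and let $\Omega^\infty:=\{u:\exists\, t_k\to+\infty,\ x_k\in\Omega,\ x_k/t_k\to u\}$ be the asymptotic cone. For $u\in\mathbb S$ write $x_k\xrightarrow{u}\infty$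 if $\|x_k\|\to\infty$ and $x_k/\|x_k\|\to u$. Put $$N_\Omega(\infty;u):=\{\xi:\exists\, x_k\in\Omega,\ x_k\xrightarrow{u}\infty,\ \xi_k\in\widehat N_\Omega(x_k),\ \xi_k\to\xi\},$$ $$\mathcal N_u:=\{\zeta\in\mathbb R^n\times\mathbb R:\exists\, x_k\xrightarrow{u}\infty,\ r_k\ge f(x_k),\ \zeta_k\in\widehat N_{\operatorname{epi}f}(x_k,r_k),\ \zeta_k\to\zeta\},$$ $$\partial f(\infty;u):=\{\xi:(\xi,-1)\in\mathcal N_u\},\qquad \partial^\infty f(\infty;u):=\{\xi:(\xi,0)\in\mathcal N_u\}.$$ Theorem. Suppose that for every $u\in\Omega^\infty\cap\mathbb S$ $$\partial^\infty f(\infty;u)\cap\bigl(-N_\Omega(\infty;u)\bigr)=\{0\}\qquad\text{and}\qquad 0\notin\partial f(\infty;u)+N_\Omega(\infty;u).$$ Then: (i) $\mathrm{Sol}$ is nonempty and compact; (ii) the problem has a weak sharp minimum at infinity, i.e. there exist $c>0$ and $R>0$ such that $f(x)-f_*\ge c\,\mathrm{dist}(x,\mathrm{Sol})$ for all $x\in\Omega$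 with $\|x\|>R$; (iii) $f$ is coercive on $\Omega$, i.e. $f(x)\to+\infty$ as $\|x\|\to\infty$ with $x\in\Omega$. -/

import Mathlib

open Filter Topology
open scoped Pointwise

/-- The regular (Fréchet) normal cone to `Ω` at `a`: the set of all `v` such that
`limsup ⟪v, x - a⟫ / ‖x - a‖ ≤ 0` as `x → a` with `x ∈ Ω`, `x ≠ a`; it is empty if `a ∉ Ω`.
The upper limit is taken in the extended reals, so it is `-∞` at an isolated point of `Ω`. -/
def regularNormalCone {E : Type*} [NormedAddCommGroup E] [InnerProductSpace ℝ E]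
    (Ω : Set E) (a : E) : Set E :=
  {v | a ∈ Ω ∧
    limsup (fun x : E => ((inner ℝ v (x - a) / ‖x - a‖ : ℝ) : EReal)) (𝓝[Ω \ {a}] a) ≤ 0}

/-- The sequence `x k` tends to infinity in the direction `u`:
`‖x k‖ → ∞` and `x k / ‖x k‖ → u`. -/
def TendstoInftyDir {E : Type*} [NormedAddCommGroup E] [InnerProductSpace ℝ E]
    (x : ℕ → E) (u : E) : Prop :=
  Tendsto (fun k => ‖x k‖) atTop atTop ∧ Tendsto (fun k => ‖x k‖⁻¹ • x k) atTop (𝓝 u)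

/-- The normal cone `N_Ω(∞; u)` to `Ω` in the direction `u` at infinity. -/
def normalConeInfty {E : Type*} [NormedAddCommGroup E] [InnerProductSpace ℝ E]
    (Ω : Set E) (u : E) : Set E :=
  {ξ | ∃ (x : ℕ → E) (η : ℕ → E), (∀ k, x k ∈ Ω) ∧ TendstoInftyDir x u ∧
    (∀ k, η k ∈ regularNormalCone Ω (x k)) ∧ Tendsto η atTop (𝓝 ξ)}

/-- The epigraph of an extended real valued function, as a subset of `E × ℝ` with the Euclidean
(Hilbert) product structure. -/
def epigraph {E : Type*} [NormedAddCommGroup E] [InnerProductSpace ℝ E]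
    (f : E → EReal) : Set (WithLp 2 (E × ℝ)) :=
  {p | f p.fst ≤ (p.snd : EReal)}

/-- The outer limit of the regular normal cones to the epigraph of `f` at `(x, r)`, as `x` tends to
infinity in the direction `u` and `r ≥ f x`. -/
def epiNormalsInfty {E : Type*} [NormedAddCommGroup E] [InnerProductSpace ℝ E]
    (f : E → EReal) (u : E) : Set (WithLp 2 (E × ℝ)) :=
  {ζ | ∃ (x : ℕ → E) (r : ℕ → ℝ) (η : ℕ → WithLp 2 (E × ℝ)), TendstoInftyDir x u ∧
    (∀ k, f (x k) ≤ (r k : EReal)) ∧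
    (∀ k, η k ∈ regularNormalCone (epigraph f) (WithLp.toLp 2 (x k, r k))) ∧
    Tendsto η atTop (𝓝 ζ)}

/-- The limiting subdifferential `∂f(∞; u)` of `f` in the direction `u` at infinity. -/
def subdiffInfty {E : Type*} [NormedAddCommGroup E] [InnerProductSpace ℝ E]
    (f : E → EReal) (u : E) : Set E :=
  {ξ | WithLp.toLp 2 (ξ, (-1 : ℝ)) ∈ epiNormalsInfty f u}

/-- The singular subdifferential `∂^∞ f(∞; u)` of `f` in the direction `u` at infinity. -/
def singularSubdiffInfty {E : Type*} [NormedAddCommGroup E] [InnerProductSpace ℝ E]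
    (f : E → EReal) (u : E) : Set E :=
  {ξ | WithLp.toLp 2 (ξ, (0 : ℝ)) ∈ epiNormalsInfty f u}

/-- The set of global solutions of the problem of minimizing `f` over `Ω`. -/
def solutionSet {E : Type*} (f : E → EReal) (Ω : Set E) : Set E :=
  {x | x ∈ Ω ∧ IsMinOn f Ω x}

/-- The optimal value `f_*` of the problem of minimizing `f` over `Ω`. -/
noncomputable def optimalValue {E : Type*} (f : E → EReal) (Ω : Set E) : EReal :=
  ⨅ x ∈ Ω, f x

/-- The problem of minimizing `f` over `Ω` has a weak sharp minimum at infinity. -/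
def HasWeakSharpMinInfty {E : Type*} [NormedAddCommGroup E] [InnerProductSpace ℝ E]
    (f : E → EReal) (Ω : Set E) : Prop :=
  ∃ c : ℝ, 0 < c ∧ ∃ R : ℝ, 0 < R ∧ ∀ x ∈ Ω \ Metric.closedBall 0 R,
    ((c * Metric.infDist x (solutionSet f Ω) : ℝ) : EReal) ≤ f x - optimalValue f Ω

/-- `f` is coercive on `Ω`: `f x → +∞` as `‖x‖ → ∞` with `x ∈ Ω`. -/
def IsCoerciveOn {E : Type*} [NormedAddCommGroup E] [InnerProductSpace ℝ E]
    (f : E → EReal) (Ω : Set E) : Prop :=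
  Tendsto f (Bornology.cobounded E ⊓ 𝓟 Ω) (𝓝 ⊤)

/-!
If `f` does not grow at least linearly on `Ω`, there are `y k ∈ Ω` with `‖y k‖ → ∞` and
`f (y k) < f_* + o(‖y k‖)`. Add to `f` a multiple of `‖x - y k‖ ^ 2` that uses up the gap
`f (y k) - f_*` on the sphere of radius `‖y k‖ / 2` around `y k`: the minimizers on the ball are
then interior and the gradient of the added term is `o(1)`. A quadratic penalty decouples `f` from
the constraint, and Fermat's rule gives regular normals `v k` to `Ω` and `η k` to `epi f`, at points
a bounded distance apart, with `(v k, 1) + η k → 0`.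

Since `v k` may be unbounded, divide by `‖(v k, 1)‖` before passing to the limit. This produces a
direction `u` and a nonzero pair `(w, τ)` with `τ ≥ 0`, `w ∈ N_Ω(∞; u)` and `-(w, τ) ∈ 𝒩_u`, which
contradicts the qualification condition if `τ = 0` and the optimality condition if `τ > 0`. All
three conclusions follow from linear growth.
-/

section RegularNormals

variable {E : Type*} [NormedAddCommGroup E] [InnerProductSpace ℝ E]

theorem mem_regularNormalCone_iff {D : Set E} {a v : E} :
    v ∈ regularNormalCone D a ↔
      a ∈ D ∧ ∀ ε > 0, ∀ᶠ x in 𝓝[D] a, inner ℝ v (x - a) ≤ ε * ‖x - a‖ := by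
  refine and_congr_right fun _ => ⟨fun h ε hε => ?_, fun h => ?_⟩
  · have hlt := eventually_lt_of_limsup_lt (h.trans_lt (EReal.coe_pos.2 hε))
    rw [eventually_nhdsWithin_iff] at hlt ⊢
    filter_upwards [hlt] with x hx hxD
    rcases eq_or_ne x a with rfl | hxa
    · simp
    · exact (div_le_iff₀ (norm_sub_pos_iff.2 hxa)).1 (EReal.coe_lt_coe_iff.1 (hx ⟨hxD, hxa⟩)).le
  · refine EReal.le_of_forall_lt_iff_le.1 fun ε hε => ?_
    refine limsup_le_of_le (h := ?_)
    filter_upwards [nhdsWithin_mono a Set.sdiff_subset (h ε (EReal.coe_pos.1 hε)),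
      self_mem_nhdsWithin] with x hx hxa
    exact EReal.coe_le_coe_iff.2 ((div_le_iff₀ (norm_sub_pos_iff.2 hxa.2)).2 hx)

theorem smul_mem_regularNormalCone {D : Set E} {a v : E} (hv : v ∈ regularNormalCone D a) {t : ℝ}
    (ht : 0 ≤ t) : t • v ∈ regularNormalCone D a := by
  rw [mem_regularNormalCone_iff] at hv ⊢
  refine ⟨hv.1, fun ε hε => ?_⟩
  filter_upwards [hv.2 (ε / (t + 1)) (by positivity)] with x hx
  have hcoef : t * (ε / (t + 1)) ≤ ε := by
    rw [mul_div_assoc', div_le_iff₀ (by positivity)]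
    nlinarith
  calc inner ℝ (t • v) (x - a) = t * inner ℝ v (x - a) := real_inner_smul_left _ _ _
    _ ≤ t * (ε / (t + 1) * ‖x - a‖) := by gcongr
    _ = t * (ε / (t + 1)) * ‖x - a‖ := by ring
    _ ≤ ε * ‖x - a‖ := by gcongr

theorem neg_mem_regularNormalCone_of_isLocalMinOn {D : Set E} {a g' : E} {g : E → ℝ} (ha : a ∈ D)
    (hmin : IsLocalMinOn g D a) (hg : HasFDerivWithinAt g (innerSL ℝ g') D a) :
    -g' ∈ regularNormalCone D a := by
  refine mem_regularNormalCone_iff.2 ⟨ha, fun ε hε => ?_⟩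
  filter_upwards [hmin, hg.isLittleO.def hε] with x hx hxε
  rw [innerSL_apply_apply, Real.norm_eq_abs] at hxε
  rw [inner_neg_left]
  linarith [(abs_le.1 hxε).2]

theorem toLp_neg_mem_regularNormalCone_epigraph {f : E → EReal} {g : E → ℝ} {x g' : E} {s : ℝ}
    (hs : f x = s) (hmin : IsLocalMin (fun y => f y + (g y : EReal)) x)
    (hg : HasFDerivAt g (innerSL ℝ g') x) :
    WithLp.toLp 2 (-g', (-1 : ℝ)) ∈ regularNormalCone (epigraph f) (WithLp.toLp 2 (x, s)) := by
  let F : WithLp 2 (E × ℝ) → ℝ := fun p => g p.fst + p.snd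
  have hF : HasFDerivAt F (innerSL ℝ (WithLp.toLp 2 (g', (1 : ℝ)))) (WithLp.toLp 2 (x, s)) := by
    have hfst : HasFDerivAt (fun p : WithLp 2 (E × ℝ) => p.fst) (WithLp.fstL 2 ℝ E ℝ)
        (WithLp.toLp 2 (x, s)) := (WithLp.fstL 2 ℝ E ℝ).hasFDerivAt
    have hsnd : HasFDerivAt (fun p : WithLp 2 (E × ℝ) => p.snd) (WithLp.sndL 2 ℝ E ℝ)
        (WithLp.toLp 2 (x, s)) := (WithLp.sndL 2 ℝ E ℝ).hasFDerivAt
    refine ((HasFDerivAt.comp _ hg hfst).add hsnd).congr_fderiv ?_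
    ext p
    simp [WithLp.prod_inner_apply]
  have hFmin : IsLocalMinOn F (epigraph f) (WithLp.toLp 2 (x, s)) := by
    have hfst : Tendsto (fun p : WithLp 2 (E × ℝ) => p.fst) (𝓝 (WithLp.toLp 2 (x, s))) (𝓝 x) :=
      (WithLp.fstL 2 ℝ E ℝ).continuous.tendsto _
    filter_upwards [nhdsWithin_le_nhds (hfst.eventually hmin), self_mem_nhdsWithin] with p hp hpf
    rw [hs, ← EReal.coe_add] at hp
    have hle := hp.trans (add_le_add_left (show f p.fst ≤ (p.snd : EReal) from hpf) _)
    rw [← EReal.coe_add, EReal.coe_le_coe_iff] at hle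
    change g x + s ≤ g p.fst + p.snd
    linarith
  have hmem : WithLp.toLp 2 (x, s) ∈ epigraph f := hs.le
  simpa [← WithLp.toLp_neg] using
    neg_mem_regularNormalCone_of_isLocalMinOn hmem hFmin hF.hasFDerivWithinAt

end RegularNormals

section QuadraticPenalty

theorem lowerSemicontinuousOn_add_coe {X : Type*} [TopologicalSpace X] {h : X → EReal} {g : X → ℝ}
    {A : Set X} (hh : LowerSemicontinuousOn h A) (hbot : ∀ x ∈ A, h x ≠ ⊥)
    (hg : ContinuousOn g A) : LowerSemicontinuousOn (fun x => h x + (g x : EReal)) A :=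
  hh.add' (continuous_coe_real_ereal.comp_continuousOn hg).lowerSemicontinuousOn fun x hx =>
    EReal.continuousAt_add (.inr (EReal.coe_ne_bot _)) (.inl (hbot x hx))

section PseudoMetric

variable {X : Type*} [PseudoMetricSpace X] {h : X → EReal} {A B : Set X}

/-- The penalized objective `h x + c * dist x z ^ 2` of the pair `(x, z)`: minimizing it over
`A ×ˢ B` decouples the minimization of `h` over `A ∩ B` into separate variables `x ∈ A` and
`z ∈ B`. -/
noncomputable def quadraticPenalty (h : X → EReal) (c : ℝ) (p : X × X) : EReal :=
  h p.1 + ((c * dist p.1 p.2 ^ 2 : ℝ) : EReal)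

theorem exists_isMinOn_quadraticPenalty (hA : IsCompact A) (hB : IsCompact B)
    (hAB : (A ∩ B).Nonempty) (hh : LowerSemicontinuousOn h A) (hbot : ∀ x ∈ A, h x ≠ ⊥) (c : ℝ) :
    ∃ p ∈ A ×ˢ B, IsMinOn (quadraticPenalty h c) (A ×ˢ B) p := by
  obtain ⟨y, hyA, hyB⟩ := hAB
  refine LowerSemicontinuousOn.exists_isMinOn ⟨(y, y), hyA, hyB⟩ (hA.prod hB) ?_
  exact lowerSemicontinuousOn_add_coe
    (hh.comp continuousOn_fst fun p hp => hp.1) (fun p hp => hbot p.1 hp.1) (by fun_prop)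

theorem quadraticPenalty_le_of_isMinOn {c : ℝ} {p : X × X} {y : X} (hy : y ∈ A ∩ B)
    (hp : IsMinOn (quadraticPenalty h c) (A ×ˢ B) p) : quadraticPenalty h c p ≤ h y := by
  simpa [quadraticPenalty] using isMinOn_iff.1 hp (y, y) hy

theorem exists_mul_dist_sq_le_of_isMinOn_quadraticPenalty (hA : IsCompact A)
    (hh : LowerSemicontinuousOn h A) (hbot : ∀ x ∈ A, h x ≠ ⊥) {y : X} (hy : y ∈ A ∩ B)
    (hytop : h y ≠ ⊤) :
    ∃ M : ℝ, ∀ c, ∀ p ∈ A ×ˢ B, IsMinOn (quadraticPenalty h c) (A ×ˢ B) p →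
      c * dist p.1 p.2 ^ 2 ≤ M := by
  obtain ⟨y₀, hy₀A, hy₀⟩ := hh.exists_isMinOn ⟨y, hy.1⟩ hA
  obtain ⟨b, -, hb⟩ := EReal.lt_iff_exists_real_btwn.1 (bot_lt_iff_ne_bot.2 (hbot y₀ hy₀A))
  refine ⟨(h y).toReal - b, fun c p hp hmin => ?_⟩
  have hle : (b : EReal) + ((c * dist p.1 p.2 ^ 2 : ℝ) : EReal) ≤ ((h y).toReal : EReal) := by
    rw [EReal.coe_toReal hytop (hbot y hy.1)]
    exact (add_le_add_left (hb.le.trans (isMinOn_iff.1 hy₀ p.1 hp.1)) _).trans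
      (quadraticPenalty_le_of_isMinOn hy hmin)
  rw [← EReal.coe_add, EReal.coe_le_coe_iff] at hle
  linarith

end PseudoMetric

variable {X : Type*} [MetricSpace X] {h : X → EReal} {A B : Set X}

theorem eq_and_isMinOn_of_tendsto_isMinOn_quadraticPenalty {ι : Type*} {l : Filter ι} [l.NeBot]
    (hA : IsCompact A) (hh : LowerSemicontinuousOn h A) (hbot : ∀ x ∈ A, h x ≠ ⊥)
    (hdom : ∃ y ∈ A ∩ B, h y ≠ ⊤) {c : ι → ℝ} (hc : Tendsto c l atTop) {p : ι → X × X}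
    (hp : ∀ i, p i ∈ A ×ˢ B) (hmin : ∀ i, IsMinOn (quadraticPenalty h (c i)) (A ×ˢ B) (p i))
    {q : X × X} (hqA : q.1 ∈ A) (hpq : Tendsto p l (𝓝 q)) :
    q.1 = q.2 ∧ IsMinOn h (A ∩ B) q.1 := by
  obtain ⟨y, hy, hytop⟩ := hdom
  obtain ⟨M, hM⟩ := exists_mul_dist_sq_le_of_isMinOn_quadraticPenalty hA hh hbot hy hytop
  have hfst : Tendsto (fun i => (p i).1) l (𝓝 q.1) := (continuous_fst.tendsto q).comp hpq
  constructor
  · have hdist : Tendsto (fun i => dist (p i).1 (p i).2 ^ 2) l (𝓝 (dist q.1 q.2 ^ 2)) :=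
      (hfst.dist ((continuous_snd.tendsto q).comp hpq)).pow 2
    have hle : dist q.1 q.2 ^ 2 ≤ 0 := by
      refine le_of_tendsto_of_tendsto hdist (hc.const_div_atTop M) ?_
      filter_upwards [hc.eventually_gt_atTop 0] with i hi
      rw [le_div_iff₀' hi]
      exact hM (c i) (p i) (hp i) (hmin i)
    exact dist_eq_zero.1 (pow_eq_zero_iff two_ne_zero |>.1 (hle.antisymm (sq_nonneg _)))
  · refine isMinOn_iff.2 fun y' hy' => ?_
    by_contra! hlt
    have hfstA : Tendsto (fun i => (p i).1) l (𝓝[A] q.1) :=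
      tendsto_nhdsWithin_iff.2 ⟨hfst, .of_forall fun i => (hp i).1⟩
    obtain ⟨i, hi, hci⟩ :=
      ((hfstA.eventually (hh q.1 hqA (h y') hlt)).and (hc.eventually_ge_atTop 0)).exists
    have hpen : h (p i).1 ≤ quadraticPenalty h (c i) (p i) :=
      le_add_of_nonneg_right (EReal.coe_nonneg.2 (by positivity))
    exact hi.not_ge (hpen.trans (quadraticPenalty_le_of_isMinOn hy' (hmin i)))

theorem eventually_mem_of_isMinOn_quadraticPenalty (hA : IsCompact A) (hB : IsCompact B)
    (hh : LowerSemicontinuousOn h A) (hbot : ∀ x ∈ A, h x ≠ ⊥) (hdom : ∃ y ∈ A ∩ B, h y ≠ ⊤)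
    {U : Set (X × X)} (hU : IsOpen U)
    (hdiag : ∀ w ∈ A ∩ B, IsMinOn h (A ∩ B) w → (w, w) ∈ U) :
    ∀ᶠ c in atTop, ∀ p ∈ A ×ˢ B, IsMinOn (quadraticPenalty h c) (A ×ˢ B) p → p ∈ U := by
  by_contra hcon
  obtain ⟨c, hc, hcp⟩ := exists_seq_forall_of_frequently (not_eventually.1 hcon)
  push Not at hcp
  choose p hp hmin hpU using hcp
  obtain ⟨q, hq, φ, hφ, hpq⟩ := (hA.prod hB).tendsto_subseq hp
  obtain ⟨hq_eq, hqmin⟩ := eq_and_isMinOn_of_tendsto_isMinOn_quadraticPenalty hA hh hbot hdom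
    (hc.comp hφ.tendsto_atTop) (fun k => hp (φ k)) (fun k => hmin (φ k)) hq.1 hpq
  have hqU : q ∈ U := by
    have hdiag_mem := hdiag q.1 ⟨hq.1, hq_eq ▸ hq.2⟩ hqmin
    rwa [show (q.1, q.1) = q from Prod.ext rfl hq_eq] at hdiag_mem
  obtain ⟨k, hk⟩ := (hpq.eventually (hU.mem_nhds hqU)).exists
  exact hpU (φ k) hk

end QuadraticPenalty

section FuzzyFermat

theorem mem_ball_of_isMinOn_add_mul_norm_sub_sq {E : Type*} [SeminormedAddCommGroup E]
    {f : E → EReal} {Ω : Set E} {m ε ρ : ℝ} (hρ : 0 < ρ) (hm : ∀ x ∈ Ω, (m : EReal) ≤ f x)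
    {x₀ w : E} (hx₀ : x₀ ∈ Ω) (hlt : f x₀ < ((m + ε : ℝ) : EReal))
    (hw : w ∈ Metric.closedBall x₀ ρ ∩ Ω)
    (hwmin : IsMinOn (fun y => f y + ((ε / ρ ^ 2 * ‖y - x₀‖ ^ 2 : ℝ) : EReal))
      (Metric.closedBall x₀ ρ ∩ Ω) w) :
    w ∈ Metric.ball x₀ ρ := by
  -- On the sphere `‖w - x₀‖ = ρ` the quadratic term equals `ε`, so no minimizer lies there.
  refine Metric.mem_ball.2 ((Metric.mem_closedBall.1 hw.1).lt_of_ne fun hwρ => ?_)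
  have hle := isMinOn_iff.1 hwmin x₀ ⟨Metric.mem_closedBall_self hρ.le, hx₀⟩
  rw [dist_eq_norm] at hwρ
  rw [hwρ, div_mul_cancel₀ ε (by positivity)] at hle
  simp only [sub_self, norm_zero, ne_eq, OfNat.ofNat_ne_zero, not_false_eq_true, zero_pow,
    mul_zero, EReal.coe_zero, add_zero] at hle
  refine (hle.trans_lt hlt).not_ge ?_
  rw [EReal.coe_add]
  exact add_le_add_left (hm w hw.2) _

variable {E : Type*} [NormedAddCommGroup E] [InnerProductSpace ℝ E] {f : E → EReal} {Ω : Set E}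

theorem hasFDerivAt_mul_norm_sub_sq (c : ℝ) (x₀ x : E) :
    HasFDerivAt (fun y => c * ‖y - x₀‖ ^ 2) (innerSL ℝ ((2 * c) • (x - x₀))) x := by
  refine (((hasFDerivAt_id x).sub_const x₀).norm_sq.const_mul c).congr_fderiv ?_
  ext y
  simp
  ring

theorem exists_opposite_normals_of_isMinOn_quadraticPenalty {g : E → ℝ} {g' : E} {K : Set E}
    {c s : ℝ} {x z : E} (hx : x ∈ interior K) (hz : z ∈ interior K) (hzΩ : z ∈ Ω) (hs : f x = s)
    (hg : HasFDerivAt g (innerSL ℝ g') x)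
    (hmin : IsMinOn (quadraticPenalty (fun y => f y + (g y : EReal)) c) (K ×ˢ (K ∩ Ω)) (x, z)) :
    ∃ v ∈ regularNormalCone Ω z,
      WithLp.toLp 2 (-(v + g'), (-1 : ℝ)) ∈
        regularNormalCone (epigraph f) (WithLp.toLp 2 (x, s)) := by
  have hzmin : IsLocalMinOn (fun z' => c * ‖z' - x‖ ^ 2) Ω z := by
    filter_upwards [self_mem_nhdsWithin, nhdsWithin_le_nhds (mem_interior_iff_mem_nhds.1 hz)]
      with z' hz'Ω hz'K
    have hle := isMinOn_iff.1 hmin (x, z') ⟨interior_subset hx, hz'K, hz'Ω⟩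
    simp only [quadraticPenalty, hs, ← EReal.coe_add, EReal.coe_le_coe_iff] at hle
    simpa only [← dist_eq_norm, dist_comm _ x, add_le_add_iff_left] using hle
  have hxmin : IsLocalMin (fun x' => f x' + ((g x' + c * ‖x' - z‖ ^ 2 : ℝ) : EReal)) x := by
    filter_upwards [mem_interior_iff_mem_nhds.1 hx] with x' hx'
    have hle := isMinOn_iff.1 hmin (x', z) ⟨hx', interior_subset hz, hzΩ⟩
    simpa only [quadraticPenalty, add_assoc, ← EReal.coe_add, dist_eq_norm] using hle
  refine ⟨-((2 * c) • (z - x)), neg_mem_regularNormalCone_of_isLocalMinOn hzΩ hzmin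
    (hasFDerivAt_mul_norm_sub_sq c x z).hasFDerivWithinAt, ?_⟩
  have hderiv := hg.add (hasFDerivAt_mul_norm_sub_sq c z x)
  rw [← map_add] at hderiv
  rw [← smul_neg, neg_sub, add_comm]
  exact toLp_neg_mem_regularNormalCone_epigraph hs hxmin hderiv

theorem exists_opposite_normals_of_forall_isMinOn_mem_interior (hbot : ∀ x, f x ≠ ⊥)
    (hlsc : LowerSemicontinuous f) (hΩ : IsClosed Ω) {g : E → ℝ} {g' : E → E}
    (hg : ∀ x, HasFDerivAt g (innerSL ℝ (g' x)) x) {K : Set E} (hK : IsCompact K)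
    (hdom : ∃ y ∈ K ∩ Ω, f y ≠ ⊤)
    (hint : ∀ w ∈ K ∩ Ω, IsMinOn (fun y => f y + (g y : EReal)) (K ∩ Ω) w → w ∈ interior K)
    {δ : ℝ} (hδ : 0 < δ) :
    ∃ x ∈ K, ∃ z ∈ Ω, dist x z < δ ∧ ∃ s : ℝ, f x = s ∧ ∃ v ∈ regularNormalCone Ω z,
      WithLp.toLp 2 (-(v + g' x), (-1 : ℝ)) ∈
        regularNormalCone (epigraph f) (WithLp.toLp 2 (x, s)) := by
  let h : E → EReal := fun y => f y + (g y : EReal)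
  have hh : LowerSemicontinuousOn h K :=
    lowerSemicontinuousOn_add_coe (hlsc.lowerSemicontinuousOn K) (fun x _ => hbot x)
      fun x _ => (hg x).continuousAt.continuousWithinAt
  have hh_bot : ∀ x ∈ K, h x ≠ ⊥ := fun x _ => by simp [h, EReal.add_eq_bot_iff, hbot x]
  obtain ⟨y, hy, hfy⟩ := hdom
  have hyK : y ∈ K ∩ (K ∩ Ω) := ⟨hy.1, hy⟩
  have hhy : h y ≠ ⊤ := (EReal.add_lt_top hfy (EReal.coe_ne_top _)).ne
  have hKΩ : IsCompact (K ∩ Ω) := hK.inter_right hΩ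
  have hU : IsOpen (interior K ×ˢ interior K ∩ {p : E × E | dist p.1 p.2 < δ}) :=
    (isOpen_interior.prod isOpen_interior).inter (isOpen_lt continuous_dist continuous_const)
  obtain ⟨c, hc⟩ := (eventually_mem_of_isMinOn_quadraticPenalty hK hKΩ hh hh_bot ⟨y, hyK, hhy⟩ hU
    fun w hw hwmin => by
      rw [← Set.inter_assoc, Set.inter_self] at hw hwmin
      exact ⟨⟨hint w hw hwmin, hint w hw hwmin⟩, by simpa using hδ⟩).exists
  obtain ⟨⟨x, z⟩, hxz, hmin⟩ := exists_isMinOn_quadraticPenalty hK hKΩ ⟨y, hyK⟩ hh hh_bot c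
  obtain ⟨⟨hx, hz⟩, hdist⟩ := hc (x, z) hxz hmin
  have hfx : f x ≠ ⊤ := fun htop => by
    have hle := quadraticPenalty_le_of_isMinOn hyK hmin
    simp only [quadraticPenalty, h, htop, EReal.top_add_coe, top_le_iff] at hle
    exact hhy hle
  have hs : f x = (f x).toReal := (EReal.coe_toReal hfx (hbot x)).symm
  exact ⟨x, hxz.1, z, hxz.2.2, hdist, _, hs,
    exists_opposite_normals_of_isMinOn_quadraticPenalty hx hz hxz.2.2 hs (hg x) hmin⟩

theorem exists_almost_opposite_normals [ProperSpace E] (hbot : ∀ x, f x ≠ ⊥)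
    (hlsc : LowerSemicontinuous f) (hΩ : IsClosed Ω) {m : ℝ} (hm : ∀ x ∈ Ω, (m : EReal) ≤ f x)
    {x₀ : E} (hx₀ : x₀ ∈ Ω) {ε ρ δ : ℝ} (hρ : 0 < ρ) (hδ : 0 < δ)
    (hlt : f x₀ < ((m + ε : ℝ) : EReal)) :
    ∃ x ∈ Metric.closedBall x₀ ρ, ∃ z ∈ Ω, dist x z < δ ∧ ∃ s : ℝ, f x = s ∧
      ∃ v ∈ regularNormalCone Ω z,
        ∃ η ∈ regularNormalCone (epigraph f) (WithLp.toLp 2 (x, s)),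
          ‖WithLp.toLp 2 (v, (1 : ℝ)) + η‖ ≤ 2 * ε / ρ := by
  have hε : 0 < ε := by
    have hmε := (hm x₀ hx₀).trans_lt hlt
    rw [EReal.coe_lt_coe_iff] at hmε
    linarith
  obtain ⟨x, hx, z, hz, hxz, s, hs, v, hv, hη⟩ :=
    exists_opposite_normals_of_forall_isMinOn_mem_interior hbot hlsc hΩ
      (hasFDerivAt_mul_norm_sub_sq (ε / ρ ^ 2) x₀) (isCompact_closedBall x₀ ρ)
      ⟨x₀, ⟨Metric.mem_closedBall_self hρ.le, hx₀⟩, (hlt.trans (EReal.coe_lt_top _)).ne⟩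
      (fun w hw hwmin => Metric.ball_subset_interior_closedBall
        (mem_ball_of_isMinOn_add_mul_norm_sub_sq hρ hm hx₀ hlt hw hwmin)) hδ
  refine ⟨x, hx, z, hz, hxz, s, hs, v, hv, _, hη, ?_⟩
  have hsum : WithLp.toLp 2 (v, (1 : ℝ)) +
      WithLp.toLp 2 (-(v + (2 * (ε / ρ ^ 2)) • (x - x₀)), (-1 : ℝ)) =
        WithLp.toLp 2 (-((2 * (ε / ρ ^ 2)) • (x - x₀)), (0 : ℝ)) := by
    rw [← WithLp.toLp_add, Prod.mk_add_mk]
    simp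
  rw [hsum, WithLp.norm_toLp_fst, norm_neg, norm_smul, Real.norm_of_nonneg (by positivity),
    ← dist_eq_norm]
  calc 2 * (ε / ρ ^ 2) * dist x x₀ ≤ 2 * (ε / ρ ^ 2) * ρ := by gcongr; exact hx
    _ = 2 * ε / ρ := by field_simp

end FuzzyFermat

section DirectionsAtInfinity

variable {E : Type*} [NormedAddCommGroup E] [InnerProductSpace ℝ E]

theorem exists_subseq_tendsto_normalized {F : Type*} [NormedAddCommGroup F] [NormedSpace ℝ F]
    [ProperSpace F] {a : ℕ → F} (ha : ∀ᶠ k in atTop, a k ≠ 0) :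
    ∃ b : F, ‖b‖ = 1 ∧ ∃ φ : ℕ → ℕ, StrictMono φ ∧
      Tendsto (fun k => ‖a (φ k)‖⁻¹ • a (φ k)) atTop (𝓝 b) := by
  have hnorm : ∀ᶠ k in atTop, ‖‖a k‖⁻¹ • a k‖ = 1 := by
    filter_upwards [ha] with k hk
    rw [norm_smul, norm_inv, norm_norm, inv_mul_cancel₀ (norm_ne_zero_iff.2 hk)]
  have hsphere : ∃ᶠ k in atTop, ‖a k‖⁻¹ • a k ∈ Metric.sphere (0 : F) 1 :=
    (hnorm.mono fun k hk => mem_sphere_zero_iff_norm.2 hk).frequently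
  obtain ⟨b, hb, φ, hφ, hlim⟩ := (isCompact_sphere (0 : F) 1).tendsto_subseq' hsphere
  exact ⟨b, mem_sphere_zero_iff_norm.1 hb, φ, hφ, hlim⟩

namespace TendstoInftyDir

variable {x : ℕ → E} {u : E}

theorem norm_eq_one (hx : TendstoInftyDir x u) : ‖u‖ = 1 := by
  refine tendsto_nhds_unique hx.2.norm (tendsto_const_nhds.congr' ?_)
  filter_upwards [hx.1.eventually_gt_atTop 0] with k hk
  rw [norm_smul, norm_inv, norm_norm, inv_mul_cancel₀ hk.ne']

theorem comp_strictMono (hx : TendstoInftyDir x u) {φ : ℕ → ℕ} (hφ : StrictMono φ) :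
    TendstoInftyDir (fun k => x (φ k)) u :=
  ⟨hx.1.comp hφ.tendsto_atTop, hx.2.comp hφ.tendsto_atTop⟩

theorem of_norm_sub_le (hx : TendstoInftyDir x u) {z : ℕ → E} {B : ℝ}
    (hxz : ∀ k, ‖x k - z k‖ ≤ B) : TendstoInftyDir z u := by
  have hz : Tendsto (fun k => ‖z k‖) atTop atTop :=
    tendsto_atTop_mono (fun k => by linarith [norm_sub_norm_le (x k) (z k), hxz k])
      (tendsto_atTop_add_const_right _ (-B) hx.1)
  have hdiff : Tendsto (fun k => ‖x k‖⁻¹ • (x k - z k)) atTop (𝓝 0) :=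
    hx.1.inv_tendsto_atTop.zero_smul_isBoundedUnder_le
      (isBoundedUnder_of ⟨B, hxz⟩)
  have hzx : Tendsto (fun k => ‖x k‖⁻¹ • z k) atTop (𝓝 u) := by
    simpa [← smul_sub] using hx.2.sub hdiff
  have hratio := (hzx.norm.inv₀ (by simp [hx.norm_eq_one])).smul hzx
  rw [hx.norm_eq_one, inv_one, one_smul] at hratio
  refine ⟨hz, hratio.congr' ?_⟩
  filter_upwards [hx.1.eventually_gt_atTop 0] with k hk
  rw [norm_smul, norm_inv, norm_norm, smul_smul]
  congr 1
  field_simp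

theorem mem_asymptoticCone (hx : TendstoInftyDir x u) {Ω : Set E} (hΩ : ∀ k, x k ∈ Ω) :
    u ∈ asymptoticCone ℝ Ω := by
  have hlim := hx.1.atTop_smul_nhds_tendsto_asymptoticNhds hx.2
  refine hlim.frequently (Eventually.frequently ?_)
  filter_upwards [hx.1.eventually_gt_atTop 0] with k hk
  rw [smul_inv_smul₀ hk.ne']
  exact hΩ k

end TendstoInftyDir

theorem exists_subseq_tendstoInftyDir [ProperSpace E] {x : ℕ → E}
    (hx : Tendsto (fun k => ‖x k‖) atTop atTop) :
    ∃ u, ∃ φ : ℕ → ℕ, StrictMono φ ∧ TendstoInftyDir (fun k => x (φ k)) u := by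
  obtain ⟨u, -, φ, hφ, hlim⟩ := exists_subseq_tendsto_normalized
    ((hx.eventually_gt_atTop 0).mono fun k hk => norm_pos_iff.1 hk)
  exact ⟨u, φ, hφ, hx.comp hφ.tendsto_atTop, hlim⟩

end DirectionsAtInfinity

section NormalsAtInfinity

variable {E : Type*} [NormedAddCommGroup E] [InnerProductSpace ℝ E] {f : E → EReal} {Ω : Set E}
  {u : E}

theorem smul_mem_normalConeInfty {ξ : E} (hξ : ξ ∈ normalConeInfty Ω u) {t : ℝ} (ht : 0 ≤ t) :
    t • ξ ∈ normalConeInfty Ω u := by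
  obtain ⟨x, η, hxΩ, hx, hη, hlim⟩ := hξ
  exact ⟨x, fun k => t • η k, hxΩ, hx, fun k => smul_mem_regularNormalCone (hη k) ht,
    hlim.const_smul t⟩

theorem smul_mem_epiNormalsInfty {ζ : WithLp 2 (E × ℝ)} (hζ : ζ ∈ epiNormalsInfty f u) {t : ℝ}
    (ht : 0 ≤ t) : t • ζ ∈ epiNormalsInfty f u := by
  obtain ⟨x, r, η, hx, hr, hη, hlim⟩ := hζ
  exact ⟨x, r, fun k => t • η k, hx, hr, fun k => smul_mem_regularNormalCone (hη k) ht,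
    hlim.const_smul t⟩

theorem eq_zero_of_opposite_normals
    (hCQ : singularSubdiffInfty f u ∩ (-normalConeInfty Ω u) ⊆ {0})
    (hOpt : (0 : E) ∉ subdiffInfty f u + normalConeInfty Ω u) {w : E} {τ : ℝ} (hτ : 0 ≤ τ)
    (hw : w ∈ normalConeInfty Ω u) (hwτ : -WithLp.toLp 2 (w, τ) ∈ epiNormalsInfty f u) :
    WithLp.toLp 2 (w, τ) = 0 := by
  rcases hτ.eq_or_lt with rfl | hτ
  · have hsing : -w ∈ singularSubdiffInfty f u := by
      simpa [singularSubdiffInfty, ← WithLp.toLp_neg] using hwτ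
    have hw0 : -w = 0 := hCQ ⟨hsing, by simpa using hw⟩
    simp [neg_eq_zero.1 hw0]
  · have hinv : 0 ≤ τ⁻¹ := inv_nonneg.2 hτ.le
    have hsub : -(τ⁻¹ • w) ∈ subdiffInfty f u := by
      simpa [subdiffInfty, ← WithLp.toLp_neg, ← WithLp.toLp_smul, hτ.ne'] using
        smul_mem_epiNormalsInfty hwτ hinv
    exact absurd (Set.mem_add.2
      ⟨_, hsub, _, smul_mem_normalConeInfty hw hinv, neg_add_cancel _⟩) hOpt

theorem exists_opposite_normals_at_infinity [FiniteDimensional ℝ E] {x z v : ℕ → E} {s : ℕ → ℝ}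
    {η : ℕ → WithLp 2 (E × ℝ)} (hx : Tendsto (fun k => ‖x k‖) atTop atTop) (hz : ∀ k, z k ∈ Ω)
    {B : ℝ} (hxz : ∀ k, ‖x k - z k‖ ≤ B) (hs : ∀ k, f (x k) ≤ (s k : EReal))
    (hv : ∀ k, v k ∈ regularNormalCone Ω (z k))
    (hη : ∀ k, η k ∈ regularNormalCone (epigraph f) (WithLp.toLp 2 (x k, s k)))
    (hsum : Tendsto (fun k => WithLp.toLp 2 (v k, (1 : ℝ)) + η k) atTop (𝓝 0)) :
    ∃ u ∈ asymptoticCone ℝ Ω ∩ Metric.sphere 0 1, ∃ (w : E) (τ : ℝ), 0 ≤ τ ∧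
      w ∈ normalConeInfty Ω u ∧ -WithLp.toLp 2 (w, τ) ∈ epiNormalsInfty f u ∧
      WithLp.toLp 2 (w, τ) ≠ 0 := by
  obtain ⟨u, φ, hφ, hxu⟩ := exists_subseq_tendstoInftyDir hx
  let ζ : ℕ → WithLp 2 (E × ℝ) := fun k => WithLp.toLp 2 (v (φ k), (1 : ℝ))
  have hζ1 : ∀ k, 1 ≤ ‖ζ k‖ := fun k => by
    simpa [ζ] using WithLp.norm_snd_le E (ζ k)
  obtain ⟨⟨w, τ⟩, hb, ψ, hψ, hlim⟩ := exists_subseq_tendsto_normalized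
    (a := ζ) (.of_forall fun k => norm_pos_iff.1 (one_pos.trans_le (hζ1 k)))
  have hxu' := hxu.comp_strictMono hψ
  have hzu := hxu'.of_norm_sub_le fun k => hxz (φ (ψ k))
  have hpos : ∀ k, 0 ≤ ‖ζ (ψ k)‖⁻¹ := fun k => by positivity
  have hlimw : Tendsto (fun k => ‖ζ (ψ k)‖⁻¹ • v (φ (ψ k))) atTop (𝓝 w) :=
    ((WithLp.fstL 2 ℝ E ℝ).continuous.tendsto _).comp hlim
  have hlimτ : Tendsto (fun k => ‖ζ (ψ k)‖⁻¹ * 1) atTop (𝓝 τ) :=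
    ((WithLp.sndL 2 ℝ E ℝ).continuous.tendsto _).comp hlim
  have hlimη : Tendsto (fun k => ‖ζ (ψ k)‖⁻¹ • η (φ (ψ k))) atTop (𝓝 (-WithLp.toLp 2 (w, τ))) := by
    have hbdd : IsBoundedUnder (· ≤ ·) atTop (norm ∘ fun k => ‖ζ (ψ k)‖⁻¹) :=
      isBoundedUnder_of ⟨1, fun k => by simpa using inv_le_one_of_one_le₀ (hζ1 (ψ k))⟩
    have hzero := hbdd.smul_tendsto_zero (hsum.comp (hφ.comp hψ).tendsto_atTop)
    simpa [ζ] using hzero.sub hlim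
  refine ⟨u, ⟨hzu.mem_asymptoticCone fun k => hz _, by simpa using hxu.norm_eq_one⟩, w, τ,
    ge_of_tendsto' hlimτ fun k => by positivity, ?_, ?_, ?_⟩
  · exact ⟨_, _, fun k => hz _, hzu, fun k => smul_mem_regularNormalCone (hv _) (hpos k), hlimw⟩
  · exact ⟨_, _, _, hxu', fun k => hs _, fun k => smul_mem_regularNormalCone (hη _) (hpos k), hlimη⟩
  · exact norm_ne_zero_iff.1 (hb.symm ▸ one_ne_zero)

theorem exists_linear_growth [FiniteDimensional ℝ E] (hbot : ∀ x, f x ≠ ⊥)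
    (hlsc : LowerSemicontinuous f) (hΩ : IsClosed Ω) {m : ℝ} (hm : ∀ x ∈ Ω, (m : EReal) ≤ f x)
    (hCQ : ∀ u ∈ asymptoticCone ℝ Ω ∩ Metric.sphere 0 1,
      singularSubdiffInfty f u ∩ (-normalConeInfty Ω u) ⊆ {0})
    (hOpt : ∀ u ∈ asymptoticCone ℝ Ω ∩ Metric.sphere 0 1,
      (0 : E) ∉ subdiffInfty f u + normalConeInfty Ω u) :
    ∃ c : ℝ, 0 < c ∧ ∀ᶠ x in Bornology.cobounded E ⊓ 𝓟 Ω,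
      ((m + c * ‖x‖ : ℝ) : EReal) ≤ f x := by
  by_contra! hcon
  have hex : ∀ k : ℕ, ∃ y ∈ Ω, (k : ℝ) + 1 ≤ ‖y‖ ∧
      f y < ((m + 1 / ((k : ℝ) + 1) * ‖y‖ : ℝ) : EReal) := fun k => by
    have hfreq := frequently_inf_principal.1 (hcon (1 / ((k : ℝ) + 1)) (by positivity))
    obtain ⟨y, ⟨hyΩ, hy⟩, hyk⟩ :=
      (hfreq.and_eventually (eventually_cobounded_le_norm ((k : ℝ) + 1))).exists
    exact ⟨y, hyΩ, hyk, hy⟩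
  choose y hyΩ hyk hy using hex
  have hypos : ∀ k, 0 < ‖y k‖ := fun k => lt_of_lt_of_le (by positivity) (hyk k)
  choose x hx z hz hxz s hs v hv η hη hnear using fun k : ℕ =>
    exists_almost_opposite_normals hbot hlsc hΩ hm (hyΩ k) (half_pos (hypos k)) one_pos (hy k)
  have hxinf : Tendsto (fun k => ‖x k‖) atTop atTop := by
    refine tendsto_atTop_mono (f := fun k : ℕ => (k : ℝ) / 2) (fun k => ?_)
      (tendsto_natCast_atTop_atTop.atTop_div_const two_pos)
    have hxy : ‖y k - x k‖ ≤ ‖y k‖ / 2 := by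
      simpa only [Metric.mem_closedBall', dist_eq_norm] using hx k
    linarith [norm_sub_norm_le (y k) (x k), hyk k]
  have hsum : Tendsto (fun k => WithLp.toLp 2 (v k, (1 : ℝ)) + η k) atTop (𝓝 0) := by
    refine squeeze_zero_norm (a := fun k : ℕ => 4 * (1 / ((k : ℝ) + 1))) (fun k => ?_) ?_
    · refine (hnear k).trans_eq ?_
      have hyk_ne : ‖y k‖ ≠ 0 := (hypos k).ne'
      field_simp
      norm_num
    · simpa using (tendsto_one_div_add_atTop_nhds_zero_nat (𝕜 := ℝ)).const_mul 4
  obtain ⟨u, hu, w, τ, hτ, hw, hwτ, hne⟩ := exists_opposite_normals_at_infinity hxinf hz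
    (fun k => by simpa only [dist_eq_norm] using (hxz k).le) (fun k => (hs k).le) hv hη hsum
  exact hne (eq_zero_of_opposite_normals (hCQ u hu) (hOpt u hu) hτ hw hwτ)

end NormalsAtInfinity

section Minimization

theorem isClosed_solutionSet {X : Type*} [TopologicalSpace X] {f : X → EReal} {Ω : Set X}
    (hlsc : LowerSemicontinuous f) (hΩ : IsClosed Ω) : IsClosed (solutionSet f Ω) := by
  have heq : solutionSet f Ω = Ω ∩ ⋂ y ∈ Ω, f ⁻¹' Set.Iic (f y) := by
    ext x
    simp [solutionSet, isMinOn_iff]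
  rw [heq]
  exact hΩ.inter (isClosed_biInter fun y _ => hlsc.isClosed_preimage (f y))

theorem exists_coe_eq_optimalValue {X : Type*} {f : X → EReal} {Ω : Set X}
    (hdom : ({x | f x < ⊤} ∩ Ω).Nonempty) (hbdd : ∃ b : ℝ, ∀ x ∈ Ω, (b : EReal) ≤ f x) :
    ∃ m : ℝ, optimalValue f Ω = m := by
  obtain ⟨x, hfx, hx⟩ := hdom
  obtain ⟨b, hb⟩ := hbdd
  have htop : optimalValue f Ω < ⊤ := (iInf₂_le x hx).trans_lt hfx
  have hbot : ⊥ < optimalValue f Ω := (EReal.bot_lt_coe b).trans_le (le_iInf₂ hb)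
  exact ⟨_, (EReal.coe_toReal htop.ne hbot.ne').symm⟩

variable {E : Type*} [NormedAddCommGroup E] [InnerProductSpace ℝ E] {f : E → EReal} {Ω : Set E}

theorem isCoerciveOn_of_linear_growth {m c : ℝ} (hc : 0 < c)
    (hgrowth : ∀ᶠ x in Bornology.cobounded E ⊓ 𝓟 Ω, ((m + c * ‖x‖ : ℝ) : EReal) ≤ f x) :
    IsCoerciveOn f Ω := by
  have hnorm : Tendsto (fun x : E => ‖x‖) (Bornology.cobounded E ⊓ 𝓟 Ω) atTop :=
    tendsto_norm_cobounded_atTop.mono_left inf_le_left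
  exact tendsto_nhds_top_mono (EReal.tendsto_coe_nhds_top_iff.2
    (tendsto_atTop_add_const_left _ m (hnorm.const_mul_atTop hc))) hgrowth

theorem hasWeakSharpMinInfty_of_linear_growth {m c : ℝ} (hc : 0 < c)
    (hm : optimalValue f Ω = m) (hne : (solutionSet f Ω).Nonempty)
    (hgrowth : ∀ᶠ x in Bornology.cobounded E ⊓ 𝓟 Ω, ((m + c * ‖x‖ : ℝ) : EReal) ≤ f x) :
    HasWeakSharpMinInfty f Ω := by
  obtain ⟨y, hy⟩ := hne
  obtain ⟨R, -, hR⟩ := (Metric.hasBasis_cobounded_compl_closedBall (0 : E)).eventually_iff.1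
    (eventually_inf_principal.1 (hgrowth.and
      ((eventually_cobounded_le_norm ‖y‖).filter_mono inf_le_left)))
  refine ⟨c / 2, half_pos hc, max R 1, by positivity, ?_⟩
  rintro x ⟨hxΩ, hx⟩
  obtain ⟨hgrow, hyx⟩ :=
    hR (fun hxR => hx (Metric.closedBall_subset_closedBall (le_max_left R 1) hxR)) hxΩ
  have hdist : Metric.infDist x (solutionSet f Ω) ≤ 2 * ‖x‖ :=
    calc Metric.infDist x (solutionSet f Ω) ≤ dist x y := Metric.infDist_le_dist_of_mem hy
      _ ≤ ‖x‖ + ‖y‖ := dist_le_norm_add_norm x y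
      _ ≤ 2 * ‖x‖ := by linarith
  rw [hm, EReal.le_sub_iff_add_le (.inl (EReal.coe_ne_bot _)) (.inl (EReal.coe_ne_top _))]
  refine le_trans ?_ hgrow
  rw [← EReal.coe_add, EReal.coe_le_coe_iff]
  nlinarith

namespace IsCoerciveOn

theorem isBounded_sublevel (hf : IsCoerciveOn f Ω) {b : EReal} (hb : b < ⊤) :
    Bornology.IsBounded (Ω ∩ f ⁻¹' Set.Iic b) := by
  rw [Bornology.isBounded_def]
  filter_upwards [eventually_inf_principal.1 (hf.eventually (lt_mem_nhds hb))] with x hx hxb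
  exact (hx hxb.1).not_ge hxb.2

variable [ProperSpace E]

theorem isCompact_sublevel (hf : IsCoerciveOn f Ω) (hlsc : LowerSemicontinuous f)
    (hΩ : IsClosed Ω) {b : EReal} (hb : b < ⊤) : IsCompact (Ω ∩ f ⁻¹' Set.Iic b) :=
  Metric.isCompact_of_isClosed_isBounded (hΩ.inter (hlsc.isClosed_preimage b))
    (hf.isBounded_sublevel hb)

theorem solutionSet_nonempty (hf : IsCoerciveOn f Ω) (hlsc : LowerSemicontinuous f)
    (hΩ : IsClosed Ω) (hdom : ({x | f x < ⊤} ∩ Ω).Nonempty) : (solutionSet f Ω).Nonempty := by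
  obtain ⟨x₀, hfx₀, hx₀⟩ := hdom
  have hx₀S : x₀ ∈ Ω ∩ f ⁻¹' Set.Iic (f x₀) := ⟨hx₀, le_refl (f x₀)⟩
  obtain ⟨y, hyS, hy⟩ := (hlsc.lowerSemicontinuousOn _).exists_isMinOn ⟨x₀, hx₀S⟩
    (hf.isCompact_sublevel hlsc hΩ hfx₀)
  refine ⟨y, hyS.1, isMinOn_iff.2 fun x hx => ?_⟩
  rcases le_total (f x) (f x₀) with hle | hle
  · exact isMinOn_iff.1 hy x ⟨hx, hle⟩
  · exact (isMinOn_iff.1 hy x₀ hx₀S).trans hle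

theorem isCompact_solutionSet (hf : IsCoerciveOn f Ω) (hlsc : LowerSemicontinuous f)
    (hΩ : IsClosed Ω) (hdom : ({x | f x < ⊤} ∩ Ω).Nonempty) : IsCompact (solutionSet f Ω) := by
  obtain ⟨x₀, hfx₀, hx₀⟩ := hdom
  exact (hf.isCompact_sublevel hlsc hΩ hfx₀).of_isClosed_subset (isClosed_solutionSet hlsc hΩ)
    fun x hx => ⟨hx.1, isMinOn_iff.1 hx.2 x₀ hx₀⟩

end IsCoerciveOn

end Minimization

theorem mainTheorem1_general {E : Type*} [NormedAddCommGroup E] [InnerProductSpace ℝ E]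
    [FiniteDimensional ℝ E] {f : E → EReal} {Ω : Set E} (hbot : ∀ x, f x ≠ ⊥)
    (hlsc : LowerSemicontinuous f) (hΩ : IsClosed Ω) (hdom : ({x | f x < ⊤} ∩ Ω).Nonempty)
    (hbdd : ∃ b : ℝ, ∀ x ∈ Ω, (b : EReal) ≤ f x)
    (hCQ : ∀ u ∈ asymptoticCone ℝ Ω ∩ Metric.sphere 0 1,
      singularSubdiffInfty f u ∩ (-normalConeInfty Ω u) ⊆ {0})
    (hOpt : ∀ u ∈ asymptoticCone ℝ Ω ∩ Metric.sphere 0 1,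
      (0 : E) ∉ subdiffInfty f u + normalConeInfty Ω u) :
    ((solutionSet f Ω).Nonempty ∧ IsCompact (solutionSet f Ω)) ∧
      HasWeakSharpMinInfty f Ω ∧ IsCoerciveOn f Ω := by
  obtain ⟨m, hm⟩ := exists_coe_eq_optimalValue hdom hbdd
  have hm_le : ∀ x ∈ Ω, (m : EReal) ≤ f x := fun x hx => hm.symm.trans_le (iInf₂_le x hx)
  obtain ⟨c, hc, hgrowth⟩ := exists_linear_growth hbot hlsc hΩ hm_le hCQ hOpt
  have hcoer : IsCoerciveOn f Ω := isCoerciveOn_of_linear_growth hc hgrowth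
  have hne : (solutionSet f Ω).Nonempty := hcoer.solutionSet_nonempty hlsc hΩ hdom
  exact ⟨⟨hne, hcoer.isCompact_solutionSet hlsc hΩ hdom⟩,
    hasWeakSharpMinInfty_of_linear_growth hc hm hne hgrowth, hcoer⟩

theorem mainTheorem1 (n : ℕ) (f : EuclideanSpace ℝ (Fin n) → EReal)
    (Ω : Set (EuclideanSpace ℝ (Fin n)))
    (hf_bot : ∀ x, f x ≠ ⊥) (hf_lsc : LowerSemicontinuous f)
    (hΩ : IsClosed Ω)
    (hA1 : ¬ Bornology.IsBounded ({x | f x < ⊤} ∩ Ω))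
    (hA2 : ∃ m : ℝ, ∀ x ∈ Ω, (m : EReal) ≤ f x)
    (hCQ : ∀ u ∈ asymptoticCone ℝ Ω ∩ Metric.sphere 0 1,
      singularSubdiffInfty f u ∩ (-normalConeInfty Ω u) = {0})
    (hOpt : ∀ u ∈ asymptoticCone ℝ Ω ∩ Metric.sphere 0 1,
      (0 : EuclideanSpace ℝ (Fin n)) ∉ subdiffInfty f u + normalConeInfty Ω u) :
    ((solutionSet f Ω).Nonempty ∧ IsCompact (solutionSet f Ω)) ∧
      HasWeakSharpMinInfty f Ω ∧ IsCoerciveOn f Ω := by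
  exact mainTheorem1_general hf_bot hf_lsc hΩ (Bornology.nonempty_of_not_isBounded hA1) hA2
    (fun u hu => (hCQ u hu).subset) hOpt
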